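/- All graphs are finite, nonempty, simple and undirected. A proper $k$-coloring of a graph $G$ is a map $f:V(G)\to\{1,\dots,k\}$ ($k\ge 1$) giving adjacent vertices different colors. Given $f$, a vertex $v$ is colorful if all $k$ colors appear on its closed neighborhood $N[v]$, and a Grundy vertex if every color $i<f(v)$ appears on its neighborhood. The coloring $f$ is a fall $k$-coloring if every vertex is colorful; a colorful $k$-coloring if every color class contains a colorful vertex; a Grundy $k$-coloring if every color class is nonempty and every vertex is a Grundy vertex; a partial Grundy $k$-coloring if every color class contains a Grundy vertex; a complete $k$-coloring if there is an edge between any two distinct color classes. Let $\mathrm{Fall}(G)$ be the set of positive integers $k$ for which $G$ has a fall $k$-coloring and, if it is nonempty, let $\chi_f(G)=\min \mathrm{Fall}(G)$ and $\psi_f(G)=\max \mathrm{Fall}(G)$. Let $\phi(G)$, $\Gamma(G)$, $\partial\Gamma(G)$, $\psi(G)$ be the largest $k$ for which $G$ has a colorful, Grundy, partial Grundy, complete $k$-coloring, respectively. Let $\chi(G)$, $\delta(G)$, $\Delta(G)$ be the chromatic number, minimum degree and maximum degree. **Theorem.** For each integer $\varepsilon>0$ there exists a graph $G$ with $\mathrm{Fall}(G)\neq\emptyset$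 such that the minimum of the eight numbers $$\chi_f(G)-\chi(G),\quad \psi_f(G)-\chi_f(G),\quad (\delta(G)+1)-\psi_f(G),\quad \Gamma(G)-\psi_f(G),$$ $$\phi(G)-\psi_f(G),\quad (\Delta(G)+1)-\partial\Gamma(G),\quad \psi(G)-\partial\Gamma(G),\quad \partial\Gamma(G)-\Gamma(G)$$ is greater than $\varepsilon$. -/

import Mathlib

namespace FallColoring

variable {V : Type*} {G : SimpleGraph V} {k : ℕ}

/-- A vertex `v` is colorful for the proper `k`-coloring `f` if every one of the `k` colors
appears on the closed neighborhood of `v`. -/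
def IsColorfulVertex (f : G.Coloring (Fin k)) (v : V) : Prop :=
  ∀ c : Fin k, ∃ w, (w = v ∨ G.Adj v w) ∧ f w = c

/-- A vertex `v` is a Grundy vertex for the proper `k`-coloring `f` if every color smaller than
`f v` appears on the neighborhood of `v`. -/
def IsGrundyVertex (f : G.Coloring (Fin k)) (v : V) : Prop :=
  ∀ c : Fin k, c < f v → ∃ w, G.Adj v w ∧ f w = c

/-- A fall coloring: every vertex is colorful. -/
def IsFallColoring (f : G.Coloring (Fin k)) : Prop :=
  ∀ v, IsColorfulVertex f v

/-- A colorful coloring (b-coloring): every color class contains a colorful vertex. -/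
def IsColorfulColoring (f : G.Coloring (Fin k)) : Prop :=
  ∀ c : Fin k, ∃ v, f v = c ∧ IsColorfulVertex f v

/-- A Grundy coloring: every color class is nonempty and every vertex is a Grundy vertex. -/
def IsGrundyColoring (f : G.Coloring (Fin k)) : Prop :=
  (∀ c : Fin k, ∃ v, f v = c) ∧ ∀ v, IsGrundyVertex f v

/-- A partial Grundy coloring: every color class contains a Grundy vertex. -/
def IsPartialGrundyColoring (f : G.Coloring (Fin k)) : Prop :=
  ∀ c : Fin k, ∃ v, f v = c ∧ IsGrundyVertex f v

/-- A complete coloring: there is an edge between any two distinct color classes. -/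
def IsCompleteColoring (f : G.Coloring (Fin k)) : Prop :=
  ∀ c d : Fin k, c ≠ d → ∃ v w, G.Adj v w ∧ f v = c ∧ f w = d

variable (G)

/-- `Fall(G)`: the set of positive integers `k` such that `G` has a fall `k`-coloring. -/
def fallSet : Set ℕ := {k | 0 < k ∧ ∃ f : G.Coloring (Fin k), IsFallColoring f}

/-- The positive integers `k` such that `G` has a colorful `k`-coloring. -/
def colorfulSet : Set ℕ := {k | 0 < k ∧ ∃ f : G.Coloring (Fin k), IsColorfulColoring f}

/-- The positive integers `k` such that `G` has a Grundy `k`-coloring. -/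
def grundySet : Set ℕ := {k | 0 < k ∧ ∃ f : G.Coloring (Fin k), IsGrundyColoring f}

/-- The positive integers `k` such that `G` has a partial Grundy `k`-coloring. -/
def partialGrundySet : Set ℕ :=
  {k | 0 < k ∧ ∃ f : G.Coloring (Fin k), IsPartialGrundyColoring f}

/-- The positive integers `k` such that `G` has a complete `k`-coloring. -/
def completeSet : Set ℕ := {k | 0 < k ∧ ∃ f : G.Coloring (Fin k), IsCompleteColoring f}

/-- The fall chromatic number `χ_f(G) = min Fall(G)`, meaningful when `Fall(G)` is nonempty. -/
noncomputable def fallChromaticNumber : ℕ := sInf (fallSet G)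

/-- The fall achromatic number `ψ_f(G) = max Fall(G)`. The maxima here and below exist for finite
nonempty graphs with `Fall(G)` nonempty, see `isGreatest_numbers`. -/
noncomputable def fallAchromaticNumber : ℕ := sSup (fallSet G)

/-- The b-chromatic number `φ(G)`. -/
noncomputable def bChromaticNumber : ℕ := sSup (colorfulSet G)

/-- The Grundy number `Γ(G)`. -/
noncomputable def grundyNumber : ℕ := sSup (grundySet G)

/-- The partial Grundy number `∂Γ(G)`. -/
noncomputable def partialGrundyNumber : ℕ := sSup (partialGrundySet G)

/-- The achromatic number `ψ(G)`. -/
noncomputable def achromaticNumber : ℕ := sSup (completeSet G)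

variable {G}

theorem IsFallColoring.isGrundyVertex {f : G.Coloring (Fin k)} (hf : IsFallColoring f) (v : V) :
    IsGrundyVertex f v := by
  intro c hc
  obtain ⟨w, rfl | hw, h⟩ := hf v c
  · exact absurd h hc.ne'
  · exact ⟨w, hw, h⟩

theorem IsFallColoring.exists_eq [Nonempty V] {f : G.Coloring (Fin k)} (hf : IsFallColoring f)
    (c : Fin k) : ∃ v, f v = c := by
  obtain ⟨v⟩ := ‹Nonempty V›
  obtain ⟨w, -, h⟩ := hf v c
  exact ⟨w, h⟩

theorem IsFallColoring.isComplete [Nonempty V] {f : G.Coloring (Fin k)}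
    (hf : IsFallColoring f) : IsCompleteColoring f := by
  intro c d hcd
  obtain ⟨v, hv⟩ := hf.exists_eq c
  obtain ⟨w, rfl | hw, h⟩ := hf v d
  · exact absurd (hv.symm.trans h) hcd
  · exact ⟨v, w, hw, hv, h⟩

theorem le_card_of_forall_exists [Fintype V] {f : G.Coloring (Fin k)}
    (hf : ∀ c : Fin k, ∃ v, f v = c) : k ≤ Fintype.card V := by
  simpa using Fintype.card_le_of_surjective f hf

theorem IsCompleteColoring.le_card [Fintype V] [Nonempty V] {f : G.Coloring (Fin k)}
    (hf : IsCompleteColoring f) : k ≤ Fintype.card V := by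
  by_cases hk : k ≤ 1
  · exact hk.trans Fintype.card_pos
  · have : Nontrivial (Fin k) := Fin.nontrivial_iff_two_le.2 (by omega)
    refine le_card_of_forall_exists (f := f) fun c => ?_
    obtain ⟨d, hd⟩ := exists_ne c
    obtain ⟨v, w, -, hv, -⟩ := hf c d hd.symm
    exact ⟨v, hv⟩

/-- On a finite nonempty graph with `Fall(G)` nonempty, all the numbers above are attained. -/
theorem isGreatest_numbers [Fintype V] [Nonempty V] (h : (fallSet G).Nonempty) :
    IsLeast (fallSet G) (fallChromaticNumber G) ∧
    IsGreatest (fallSet G) (fallAchromaticNumber G) ∧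
    IsGreatest (colorfulSet G) (bChromaticNumber G) ∧
    IsGreatest (grundySet G) (grundyNumber G) ∧
    IsGreatest (partialGrundySet G) (partialGrundyNumber G) ∧
    IsGreatest (completeSet G) (achromaticNumber G) := by
  have key : ∀ S : Set ℕ, S.Nonempty → (∀ k ∈ S, k ≤ Fintype.card V) →
      IsGreatest S (sSup S) := fun S hS hb =>
    ⟨Nat.sSup_mem hS ⟨_, hb⟩, fun _ hk => le_csSup ⟨_, hb⟩ hk⟩
  have h' := h
  obtain ⟨k, hk, f, hf⟩ := h'
  refine ⟨⟨Nat.sInf_mem h, fun _ hk => Nat.sInf_le hk⟩, key _ h ?_, key _ ⟨k, hk, f, ?_⟩ ?_,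
    key _ ⟨k, hk, f, ?_⟩ ?_, key _ ⟨k, hk, f, ?_⟩ ?_, key _ ⟨k, hk, f, ?_⟩ ?_⟩
  · rintro l ⟨-, g, hg⟩
    exact le_card_of_forall_exists hg.exists_eq
  · intro c
    obtain ⟨v, hv⟩ := hf.exists_eq c
    exact ⟨v, hv, hf v⟩
  · rintro l ⟨-, g, hg⟩
    exact le_card_of_forall_exists fun c => (hg c).imp fun _ h => h.1
  · exact ⟨hf.exists_eq, hf.isGrundyVertex⟩
  · rintro l ⟨-, g, hg⟩
    exact le_card_of_forall_exists hg.1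
  · intro c
    obtain ⟨v, hv⟩ := hf.exists_eq c
    exact ⟨v, hv, hf.isGrundyVertex v⟩
  · rintro l ⟨-, g, hg⟩
    exact le_card_of_forall_exists fun c => (hg c).imp fun _ h => h.1
  · exact hf.isComplete
  · rintro l ⟨-, g, hg⟩
    exact hg.le_card

end FallColoring

namespace FallColoring

open SimpleGraph
open scoped Pointwise

variable {V W : Type*} {G : SimpleGraph V} {H : SimpleGraph W} {k a b : ℕ}

/-! ### Implications between the kinds of colorings -/

/-! In a join, vertices on opposite sides are adjacent, so the sides use disjoint palettes and a
coloring splits into one coloring per side. Hence the fall, Grundy and partial Grundy sets of a join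
are sumsets, the b-chromatic and achromatic numbers are superadditive, and χ is subadditive. Each
lies on the right side of the inequalities in `HasGaps`, so gaps add under joins (`HasGaps.join`),
and it suffices to open each gap in a separate graph.

The pieces are: K₂ × Kₙ, with fall 2- and n-colorings; K₂ × Kₙ ⊔ K₃ × Kₙ, where χ ≤ 3 but no fall
coloring has fewer than n colors; K₂ × Kₙ ⊔ K₂, where K₂ caps fall colorings at 2 colors while Γ ≥
n; and many copies of K_{n,n}, where Γ ≤ 2, φ and ∂Γ are n + 1, and ψ grows with the number of
copies.

Joining with an edgeless graph then raises the degrees of the old vertices by its order, but ψ_f and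
∂Γ by at most 1. This opens the two degree gaps. -/

theorem IsColorfulVertex.isGrundyVertex {f : G.Coloring (Fin k)} {v : V}
    (hf : IsColorfulVertex f v) : IsGrundyVertex f v := by
  intro c hc
  obtain ⟨w, rfl | hw, h⟩ := hf c
  · exact absurd h hc.ne'
  · exact ⟨w, hw, h⟩

theorem IsPartialGrundyColoring.isComplete {f : G.Coloring (Fin k)}
    (hf : IsPartialGrundyColoring f) : IsCompleteColoring f := by
  intro c d hcd
  rcases hcd.lt_or_gt with h | h
  · obtain ⟨v, rfl, hv⟩ := hf d
    obtain ⟨w, hw, hwc⟩ := hv c h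
    exact ⟨w, v, hw.symm, hwc, rfl⟩
  · obtain ⟨v, rfl, hv⟩ := hf c
    obtain ⟨w, hw, hwc⟩ := hv d h
    exact ⟨v, w, hw, rfl, hwc⟩

theorem colorfulSet_subset_partialGrundySet : colorfulSet G ⊆ partialGrundySet G := by
  rintro k ⟨hk, f, hf⟩
  refine ⟨hk, f, fun c => ?_⟩
  obtain ⟨v, hv, h⟩ := hf c
  exact ⟨v, hv, h.isGrundyVertex⟩

theorem grundySet_subset_partialGrundySet : grundySet G ⊆ partialGrundySet G := by
  rintro k ⟨hk, f, hf⟩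
  refine ⟨hk, f, fun c => ?_⟩
  obtain ⟨v, hv⟩ := hf.1 c
  exact ⟨v, hv, hf.2 v⟩

theorem partialGrundySet_subset_completeSet : partialGrundySet G ⊆ completeSet G :=
  fun _ ⟨hk, f, hf⟩ => ⟨hk, f, hf.isComplete⟩

theorem fallSet_subset_grundySet [Nonempty V] : fallSet G ⊆ grundySet G :=
  fun _ ⟨hk, f, hf⟩ => ⟨hk, f, hf.exists_eq, hf.isGrundyVertex⟩

theorem fallSet_subset_colorfulSet [Nonempty V] : fallSet G ⊆ colorfulSet G := by
  rintro k ⟨hk, f, hf⟩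
  refine ⟨hk, f, fun c => ?_⟩
  obtain ⟨v, hv⟩ := hf.exists_eq c
  exact ⟨v, hv, hf v⟩

theorem IsColorfulVertex.le_degree_add_one [Fintype V] [DecidableRel G.Adj]
    {f : G.Coloring (Fin k)} {v : V} (hf : IsColorfulVertex f v) : k ≤ G.degree v + 1 := by
  classical
  have h : (Finset.univ : Finset (Fin k)) ⊆ (insert v (G.neighborFinset v)).image f := by
    intro c _
    obtain ⟨w, hw, rfl⟩ := hf c
    exact Finset.mem_image_of_mem _ (by simpa using hw)
  calc k = (Finset.univ : Finset (Fin k)).card := by simp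
    _ ≤ _ := (Finset.card_le_card h).trans Finset.card_image_le
    _ ≤ _ := (Finset.card_insert_le v (G.neighborFinset v)).trans_eq (by simp)

theorem IsGrundyVertex.le_degree [Fintype V] [DecidableRel G.Adj]
    {f : G.Coloring (Fin k)} {v : V} (hf : IsGrundyVertex f v) : (f v : ℕ) ≤ G.degree v := by
  classical
  have h : Finset.Iio (f v) ⊆ (G.neighborFinset v).image f := by
    intro c hc
    obtain ⟨w, hw, rfl⟩ := hf c (by simpa using hc)
    exact Finset.mem_image_of_mem _ (by simpa using hw)
  calc (f v : ℕ) = (Finset.Iio (f v)).card := by simp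
    _ ≤ _ := (Finset.card_le_card h).trans Finset.card_image_le
    _ = _ := by simp

theorem le_of_mem_fallSet [Fintype V] [Nonempty V] [DecidableRel G.Adj] (hk : k ∈ fallSet G) :
    k ≤ G.minDegree + 1 := by
  obtain ⟨v, hv⟩ := G.exists_minimal_degree_vertex
  obtain ⟨-, f, hf⟩ := hk
  exact hv ▸ (hf v).le_degree_add_one

theorem le_of_mem_partialGrundySet [Fintype V] [DecidableRel G.Adj]
    (hk : k ∈ partialGrundySet G) : k ≤ G.maxDegree + 1 := by
  obtain ⟨hk, f, hf⟩ := hk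
  -- Colors start at 0, so a Grundy vertex of the top color `k - 1` has at least `k - 1` neighbors.
  obtain ⟨v, hv, h⟩ := hf ⟨k - 1, by omega⟩
  have h1 := h.le_degree.trans (G.degree_le_maxDegree v)
  rw [hv] at h1
  simp only at h1
  omega

/-! ### Joins -/

theorem isLeast_add {S T : Set ℕ} (ha : IsLeast S a) (hb : IsLeast T b) :
    IsLeast (S + T) (a + b) := by
  refine ⟨Set.add_mem_add ha.1 hb.1, ?_⟩
  rintro _ ⟨x, hx, y, hy, rfl⟩
  exact add_le_add (ha.2 hx) (hb.2 hy)

theorem isGreatest_add {S T : Set ℕ} (ha : IsGreatest S a) (hb : IsGreatest T b) :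
    IsGreatest (S + T) (a + b) := by
  refine ⟨Set.add_mem_add ha.1 hb.1, ?_⟩
  rintro _ ⟨x, hx, y, hy, rfl⟩
  exact add_le_add (ha.2 hx) (hb.2 hy)


/-- The join of two graphs: their disjoint union together with all edges between them. -/
def join (G : SimpleGraph V) (H : SimpleGraph W) : SimpleGraph (V ⊕ W) where
  Adj
    | .inl v, .inl v' => G.Adj v v'
    | .inr w, .inr w' => H.Adj w w'
    | _, _ => True
  symm.symm
    | .inl _, .inl _ => G.adj_symm
    | .inr _, .inr _ => H.adj_symm
    | .inl _, .inr _ | .inr _, .inl _ => id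
  loopless := ⟨by rintro (v | v) <;> simp⟩

@[simp] theorem join_adj_inl_inl {v v' : V} :
    (join G H).Adj (.inl v) (.inl v') ↔ G.Adj v v' := Iff.rfl

@[simp] theorem join_adj_inr_inr {w w' : W} :
    (join G H).Adj (.inr w) (.inr w') ↔ H.Adj w w' := Iff.rfl

@[simp] theorem join_adj_inl_inr {v : V} {w : W} : (join G H).Adj (.inl v) (.inr w) := trivial

@[simp] theorem join_adj_inr_inl {v : V} {w : W} : (join G H).Adj (.inr w) (.inl v) := trivial

/-- The embedding of the left part into the join. -/
def joinInl (G : SimpleGraph V) (H : SimpleGraph W) : G ↪g join G H where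
  toFun := .inl
  inj' := Sum.inl_injective
  map_rel_iff' := Iff.rfl

/-- The embedding of the right part into the join. -/
def joinInr (G : SimpleGraph V) (H : SimpleGraph W) : H ↪g join G H where
  toFun := .inr
  inj' := Sum.inr_injective
  map_rel_iff' := Iff.rfl

/-- Colorings of the parts of a join with disjoint palettes, put together. -/
def joinColoring (f : G.Coloring (Fin a)) (g : H.Coloring (Fin b)) :
    (join G H).Coloring (Fin (a + b)) :=
  Coloring.mk (Sum.elim (fun v => Fin.castAdd b (f v)) (fun w => Fin.natAdd a (g w))) <| by
    rintro (v | v) (w | w) h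
    · simpa using f.valid h
    · simp [Fin.ext_iff]; omega
    · simp [Fin.ext_iff]; omega
    · simpa [Fin.ext_iff] using g.valid h

section joinColoring

variable {f : G.Coloring (Fin a)} {g : H.Coloring (Fin b)}

@[simp] theorem joinColoring_inl (v : V) : joinColoring f g (.inl v) = Fin.castAdd b (f v) := rfl

@[simp] theorem joinColoring_inr (w : W) : joinColoring f g (.inr w) = Fin.natAdd a (g w) := rfl

theorem IsColorfulVertex.joinColoring_inl {v : V} (hf : IsColorfulVertex f v)
    (hg : ∀ c, ∃ w, g w = c) : IsColorfulVertex (joinColoring f g) (.inl v) := by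
  intro c
  induction c using Fin.addCases with
  | left c =>
    obtain ⟨w, hw, rfl⟩ := hf c
    exact ⟨.inl w, by simpa using hw, rfl⟩
  | right c =>
    obtain ⟨w, rfl⟩ := hg c
    exact ⟨.inr w, by simp, rfl⟩

theorem IsColorfulVertex.joinColoring_inr {w : W} (hg : IsColorfulVertex g w)
    (hf : ∀ c, ∃ v, f v = c) : IsColorfulVertex (joinColoring f g) (.inr w) := by
  intro c
  induction c using Fin.addCases with
  | left c =>
    obtain ⟨w, rfl⟩ := hf c
    exact ⟨.inl w, by simp, rfl⟩
  | right c =>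
    obtain ⟨w, hw, rfl⟩ := hg c
    exact ⟨.inr w, by simpa using hw, rfl⟩

/-- The left palette lies below the right one, so nothing is asked of `g`; on the right side, by
contrast, `f` must use all its colors. -/
theorem IsGrundyVertex.joinColoring_inl {v : V} (hf : IsGrundyVertex f v) :
    IsGrundyVertex (joinColoring f g) (.inl v) := by
  intro c hc
  induction c using Fin.addCases with
  | left c =>
    obtain ⟨w, hw, rfl⟩ := hf c hc
    exact ⟨.inl w, hw, rfl⟩
  | right c =>
    simp [Fin.lt_def] at hc
    omega

theorem IsGrundyVertex.joinColoring_inr {w : W} (hg : IsGrundyVertex g w)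
    (hf : ∀ c, ∃ v, f v = c) : IsGrundyVertex (joinColoring f g) (.inr w) := by
  intro c hc
  induction c using Fin.addCases with
  | left c =>
    obtain ⟨w, rfl⟩ := hf c
    exact ⟨.inl w, by simp, rfl⟩
  | right c =>
    obtain ⟨w, hw, rfl⟩ := hg c (Fin.lt_def.2 (Nat.lt_of_add_lt_add_left (n := a) hc))
    exact ⟨.inr w, hw, rfl⟩

theorem joinColoring_surjective (hf : ∀ c, ∃ v, f v = c) (hg : ∀ c, ∃ w, g w = c)
    (c : Fin (a + b)) : ∃ x, joinColoring f g x = c := by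
  induction c using Fin.addCases with
  | left c => obtain ⟨v, rfl⟩ := hf c; exact ⟨.inl v, rfl⟩
  | right c => obtain ⟨v, rfl⟩ := hg c; exact ⟨.inr v, rfl⟩

end joinColoring

/-! ### Restricting a coloring to one side of a join. -/

section restrict

variable [Fintype W] (φ : H ↪g G) (f : G.Coloring (Fin k))

/-- The colors used by `f` on the image of `φ`. -/
def colorsOn : Finset (Fin k) := Finset.univ.image fun w => f (φ w)

theorem mem_colorsOn (w : W) : f (φ w) ∈ colorsOn φ f :=
  Finset.mem_image_of_mem _ (Finset.mem_univ w)

/-- The coloring `f` pulled back along `φ`, its colors renumbered in increasing order. -/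
noncomputable def restrictColoring : H.Coloring (Fin (colorsOn φ f).card) :=
  Coloring.mk (fun w => ((colorsOn φ f).orderIsoOfFin rfl).symm ⟨f (φ w), mem_colorsOn φ f w⟩) <| by
    intro v w h
    simpa using f.valid (φ.map_adj_iff.2 h)

variable {φ f}

theorem restrictColoring_eq_iff {w : W} {c : Fin (colorsOn φ f).card} :
    restrictColoring φ f w = c ↔ f (φ w) = ((colorsOn φ f).orderIsoOfFin rfl c : Fin k) := by
  change ((colorsOn φ f).orderIsoOfFin rfl).symm _ = c ↔ _
  rw [OrderIso.symm_apply_eq, Subtype.ext_iff]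

theorem lt_restrictColoring_iff {w : W} {c : Fin (colorsOn φ f).card} :
    c < restrictColoring φ f w ↔ ((colorsOn φ f).orderIsoOfFin rfl c : Fin k) < f (φ w) := by
  change c < ((colorsOn φ f).orderIsoOfFin rfl).symm _ ↔ _
  rw [OrderIso.lt_symm_apply, ← Subtype.coe_lt_coe]

theorem restrictColoring_surjective (c : Fin (colorsOn φ f).card) :
    ∃ w, restrictColoring φ f w = c := by
  obtain ⟨w, -, hw⟩ := Finset.mem_image.1 ((colorsOn φ f).orderIsoOfFin rfl c).2
  exact ⟨w, restrictColoring_eq_iff.2 hw⟩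

/-- A vertex outside the image is adjacent to the whole image, so it shares no color with it.
Witnesses for colors of the image therefore lie in the image. -/
theorem exists_eq_of_mem_colorsOn (hφ : ∀ v ∉ Set.range φ, ∀ w, G.Adj v (φ w)) {v : V}
    (hv : f v ∈ colorsOn φ f) : ∃ w, φ w = v := by
  by_contra h
  obtain ⟨w, -, hw⟩ := Finset.mem_image.1 hv
  exact f.valid (hφ v h w) hw.symm

theorem IsColorfulVertex.restrictColoring (hφ : ∀ v ∉ Set.range φ, ∀ w, G.Adj v (φ w)) {w : W}
    (h : IsColorfulVertex f (φ w)) : IsColorfulVertex (restrictColoring φ f) w := by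
  intro c
  obtain ⟨v, hv, hvc⟩ := h ((colorsOn φ f).orderIsoOfFin rfl c)
  obtain ⟨u, rfl⟩ := exists_eq_of_mem_colorsOn (f := f) hφ (hvc ▸ Subtype.coe_prop _)
  exact ⟨u, by simpa using hv, restrictColoring_eq_iff.2 hvc⟩

/-- The renumbering is increasing, so smaller colors remain smaller and their witnesses stay inside
the image. -/
theorem IsGrundyVertex.restrictColoring (hφ : ∀ v ∉ Set.range φ, ∀ w, G.Adj v (φ w)) {w : W}
    (h : IsGrundyVertex f (φ w)) : IsGrundyVertex (restrictColoring φ f) w := by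
  intro c hc
  obtain ⟨v, hv, hvc⟩ := h ((colorsOn φ f).orderIsoOfFin rfl c) (lt_restrictColoring_iff.1 hc)
  obtain ⟨u, rfl⟩ := exists_eq_of_mem_colorsOn (f := f) hφ (hvc ▸ Subtype.coe_prop _)
  exact ⟨u, by simpa using hv, restrictColoring_eq_iff.2 hvc⟩

theorem IsPartialGrundyColoring.restrictColoring (hφ : ∀ v ∉ Set.range φ, ∀ w, G.Adj v (φ w))
    (h : IsPartialGrundyColoring f) : IsPartialGrundyColoring (restrictColoring φ f) := by
  intro c
  obtain ⟨v, hvc, hv⟩ := h ((colorsOn φ f).orderIsoOfFin rfl c)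
  obtain ⟨u, rfl⟩ := exists_eq_of_mem_colorsOn (f := f) hφ (hvc ▸ Subtype.coe_prop _)
  exact ⟨u, restrictColoring_eq_iff.2 hvc, hv.restrictColoring hφ⟩

theorem colorsOn_card_pos [Nonempty W] : 0 < (colorsOn φ f).card :=
  Finset.card_pos.2 (Finset.univ_nonempty.image _)

end restrict

theorem joinInl_adj (v) (hv : v ∉ Set.range (joinInl G H)) (w) :
    (join G H).Adj v (joinInl G H w) := by
  rcases v with v | v
  · exact absurd ⟨v, rfl⟩ hv
  · trivial

theorem joinInr_adj (v) (hv : v ∉ Set.range (joinInr G H)) (w) :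
    (join G H).Adj v (joinInr G H w) := by
  rcases v with v | v
  · trivial
  · exact absurd ⟨v, rfl⟩ hv

theorem card_colorsOn_join [Fintype V] [Fintype W] {f : (join G H).Coloring (Fin k)}
    (hf : ∀ c, ∃ x, f x = c) :
    (colorsOn (joinInl G H) f).card + (colorsOn (joinInr G H) f).card = k := by
  rw [← Finset.card_union_of_disjoint, Finset.eq_univ_of_forall (s := _ ∪ _), Finset.card_univ,
    Fintype.card_fin]
  · intro c
    obtain ⟨v | w, rfl⟩ := hf c
    · exact Finset.mem_union_left _ (mem_colorsOn (joinInl G H) f v)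
    · exact Finset.mem_union_right _ (mem_colorsOn (joinInr G H) f w)
  · rw [Finset.disjoint_left]
    intro c hc hd
    obtain ⟨v, -, rfl⟩ := Finset.mem_image.1 hc
    obtain ⟨w, -, h⟩ := Finset.mem_image.1 hd
    exact f.valid (join_adj_inl_inr (G := G) (H := H) (v := v) (w := w)) h.symm

/-! ### Sets of color numbers of a join. -/

section joinSets

variable [Fintype V] [Nonempty V] [Fintype W] [Nonempty W]

theorem fallSet_join : fallSet (join G H) = fallSet G + fallSet H := by
  apply subset_antisymm
  · rintro k ⟨hk, f, hf⟩
    exact ⟨_, ⟨colorsOn_card_pos, _, fun v => (hf (.inl v)).restrictColoring joinInl_adj⟩,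
      _, ⟨colorsOn_card_pos, _, fun v => (hf (.inr v)).restrictColoring joinInr_adj⟩,
      card_colorsOn_join hf.exists_eq⟩
  · rintro _ ⟨a, ⟨ha, f, hf⟩, b, ⟨hb, g, hg⟩, rfl⟩
    refine ⟨Nat.add_pos_left ha _, joinColoring f g, ?_⟩
    rintro (v | w)
    · exact (hf v).joinColoring_inl hg.exists_eq
    · exact (hg w).joinColoring_inr hf.exists_eq

theorem grundySet_join : grundySet (join G H) = grundySet G + grundySet H := by
  apply subset_antisymm
  · rintro k ⟨hk, f, hf⟩
    exact ⟨_, ⟨colorsOn_card_pos, _, restrictColoring_surjective,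
        fun v => (hf.2 (.inl v)).restrictColoring joinInl_adj⟩,
      _, ⟨colorsOn_card_pos, _, restrictColoring_surjective,
        fun v => (hf.2 (.inr v)).restrictColoring joinInr_adj⟩,
      card_colorsOn_join hf.1⟩
  · rintro _ ⟨a, ⟨ha, f, hf⟩, b, ⟨hb, g, hg⟩, rfl⟩
    refine ⟨Nat.add_pos_left ha _, joinColoring f g, joinColoring_surjective hf.1 hg.1, ?_⟩
    rintro (v | w)
    · exact (hf.2 v).joinColoring_inl
    · exact (hg.2 w).joinColoring_inr hf.1

theorem partialGrundySet_join :
    partialGrundySet (join G H) = partialGrundySet G + partialGrundySet H := by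
  apply subset_antisymm
  · rintro k ⟨hk, f, hf⟩
    exact ⟨_, ⟨colorsOn_card_pos, _, hf.restrictColoring joinInl_adj⟩,
      _, ⟨colorsOn_card_pos, _, hf.restrictColoring joinInr_adj⟩,
      card_colorsOn_join fun c => (hf c).imp fun _ h => h.1⟩
  · rintro _ ⟨a, ⟨ha, f, hf⟩, b, ⟨hb, g, hg⟩, rfl⟩
    refine ⟨Nat.add_pos_left ha _, joinColoring f g, fun c => ?_⟩
    induction c using Fin.addCases with
    | left c =>
      obtain ⟨v, rfl, hv⟩ := hf c
      exact ⟨.inl v, rfl, hv.joinColoring_inl⟩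
    | right c =>
      obtain ⟨v, rfl, hv⟩ := hg c
      exact ⟨.inr v, rfl, hv.joinColoring_inr fun c => (hf c).imp fun _ h => h.1⟩

end joinSets

/-- This inclusion suffices because φ enters the gaps only as the larger term; the same applies to ψ
below. -/
theorem colorfulSet_add_subset_join : colorfulSet G + colorfulSet H ⊆ colorfulSet (join G H) := by
  rintro _ ⟨a, ⟨ha, f, hf⟩, b, ⟨hb, g, hg⟩, rfl⟩
  refine ⟨Nat.add_pos_left ha _, joinColoring f g, fun c => ?_⟩
  induction c using Fin.addCases with
  | left c =>
    obtain ⟨v, rfl, hv⟩ := hf c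
    exact ⟨.inl v, rfl, hv.joinColoring_inl fun c => (hg c).imp fun _ h => h.1⟩
  | right c =>
    obtain ⟨v, rfl, hv⟩ := hg c
    exact ⟨.inr v, rfl, hv.joinColoring_inr fun c => (hf c).imp fun _ h => h.1⟩

theorem IsCompleteColoring.exists_eq [Nonempty V] {f : G.Coloring (Fin k)}
    (hf : IsCompleteColoring f) (c : Fin k) : ∃ v, f v = c := by
  by_cases h : ∃ d, d ≠ c
  · obtain ⟨d, hd⟩ := h
    obtain ⟨v, -, -, hv, -⟩ := hf c d hd.symm
    exact ⟨v, hv⟩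
  -- With a single color completeness is vacuous, and any vertex will do.
  · push Not at h
    exact ‹Nonempty V›.elim fun v => ⟨v, h _⟩

theorem completeSet_add_subset_join [Nonempty V] [Nonempty W] :
    completeSet G + completeSet H ⊆ completeSet (join G H) := by
  rintro _ ⟨a, ⟨ha, f, hf⟩, b, ⟨hb, g, hg⟩, rfl⟩
  refine ⟨Nat.add_pos_left ha _, joinColoring f g, fun c d hcd => ?_⟩
  induction c using Fin.addCases with
  | left c =>
    induction d using Fin.addCases with
    | left d =>
      obtain ⟨v, w, h, rfl, rfl⟩ := hf c d fun h => hcd (h ▸ rfl)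
      exact ⟨.inl v, .inl w, h, rfl, rfl⟩
    | right d =>
      obtain ⟨v, rfl⟩ := hf.exists_eq c
      obtain ⟨w, rfl⟩ := hg.exists_eq d
      exact ⟨.inl v, .inr w, trivial, rfl, rfl⟩
  | right c =>
    induction d using Fin.addCases with
    | left d =>
      obtain ⟨v, rfl⟩ := hg.exists_eq c
      obtain ⟨w, rfl⟩ := hf.exists_eq d
      exact ⟨.inr v, .inl w, trivial, rfl, rfl⟩
    | right d =>
      obtain ⟨v, w, h, rfl, rfl⟩ := hg c d fun h => hcd (h ▸ rfl)
      exact ⟨.inr v, .inr w, h, rfl, rfl⟩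

theorem le_degree_join_inl [Fintype V] [Fintype W] [DecidableRel G.Adj]
    [DecidableRel (join G H).Adj] (v : V) :
    G.degree v + Fintype.card W ≤ (join G H).degree (.inl v) := by
  rw [← card_neighborFinset_eq_degree, ← card_neighborFinset_eq_degree, ← Finset.card_univ,
    ← Finset.card_disjSum]
  refine Finset.card_le_card fun x hx => ?_
  rcases x with x | x <;> simp_all

theorem le_degree_join_inr [Fintype V] [Fintype W] [DecidableRel (join G H).Adj] (w : W) :
    Fintype.card V ≤ (join G H).degree (.inr w) := by
  rw [← card_neighborFinset_eq_degree, ← Finset.card_univ,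
    ← Finset.card_map ⟨Sum.inl (β := W), Sum.inl_injective⟩]
  refine Finset.card_le_card fun x hx => ?_
  rcases x with x | x <;> simp_all

/-! ### Gaps between the numbers -/

/-- Lower bounds for the differences of consecutive numbers, other than those that involve
degrees. -/
structure HasGaps (G : SimpleGraph V) (fall_chrom fallAchrom_fall grundy_fallAchrom
    b_fallAchrom achrom_partial partial_grundy : ℕ) : Prop where
  nonempty : (fallSet G).Nonempty
  fall_chrom : G.chromaticNumber.toNat + fall_chrom ≤ fallChromaticNumber G
  fallAchrom_fall : fallChromaticNumber G + fallAchrom_fall ≤ fallAchromaticNumber G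
  grundy_fallAchrom : fallAchromaticNumber G + grundy_fallAchrom ≤ grundyNumber G
  b_fallAchrom : fallAchromaticNumber G + b_fallAchrom ≤ bChromaticNumber G
  achrom_partial : partialGrundyNumber G + achrom_partial ≤ achromaticNumber G
  partial_grundy : grundyNumber G + partial_grundy ≤ partialGrundyNumber G

theorem chromaticNumber_toNat_le (f : G.Coloring (Fin k)) : G.chromaticNumber.toNat ≤ k :=
  ENat.toNat_le_of_le_natCast (Colorable.chromaticNumber_le ⟨f⟩)

theorem chromaticNumber_join_toNat_le [Finite V] [Finite W] :
    (join G H).chromaticNumber.toNat ≤ G.chromaticNumber.toNat + H.chromaticNumber.toNat := by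
  obtain ⟨f⟩ := G.colorable_chromaticNumber_of_fintype
  obtain ⟨g⟩ := H.colorable_chromaticNumber_of_fintype
  exact chromaticNumber_toNat_le (joinColoring f g)

section finite

variable [Fintype V] [Nonempty V]

/-- No gap is negative. The building blocks below take their default fields from here and override
those they enlarge. -/
theorem hasGaps_zero (h : (fallSet G).Nonempty) : HasGaps G 0 0 0 0 0 0 := by
  obtain ⟨⟨⟨-, f, -⟩, -⟩, hψ, hφ, hΓ, hp, hc⟩ := isGreatest_numbers h
  exact ⟨h, chromaticNumber_toNat_le f, Nat.sInf_le hψ.1, hΓ.2 (fallSet_subset_grundySet hψ.1),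
    hφ.2 (fallSet_subset_colorfulSet hψ.1), hc.2 (partialGrundySet_subset_completeSet hp.1),
    hp.2 (grundySet_subset_partialGrundySet hΓ.1)⟩

variable [Fintype W] [Nonempty W]

theorem HasGaps.join {a₁ a₂ a₃ a₄ a₅ a₆ b₁ b₂ b₃ b₄ b₅ b₆ : ℕ}
    (hG : HasGaps G a₁ a₂ a₃ a₄ a₅ a₆) (hH : HasGaps H b₁ b₂ b₃ b₄ b₅ b₆) :
    HasGaps (join G H) (a₁ + b₁) (a₂ + b₂) (a₃ + b₃) (a₄ + b₄) (a₅ + b₅) (a₆ + b₆) := by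
  obtain ⟨hf, hψ, hφ, hΓ, hp, hc⟩ := isGreatest_numbers hG.nonempty
  obtain ⟨hf', hψ', hφ', hΓ', hp', hc'⟩ := isGreatest_numbers hH.nonempty
  have hne : (fallSet (FallColoring.join G H)).Nonempty := by
    rw [fallSet_join]
    exact hG.nonempty.add hH.nonempty
  obtain ⟨jf, jψ, jφ, jΓ, jp, jc⟩ := isGreatest_numbers hne
  have ef := jf.unique (fallSet_join (G := G) (H := H) ▸ isLeast_add hf hf')
  have eψ := jψ.unique (fallSet_join (G := G) (H := H) ▸ isGreatest_add hψ hψ')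
  have eΓ := jΓ.unique (grundySet_join (G := G) (H := H) ▸ isGreatest_add hΓ hΓ')
  have ep := jp.unique (partialGrundySet_join (G := G) (H := H) ▸ isGreatest_add hp hp')
  have lφ := jφ.2 (colorfulSet_add_subset_join (Set.add_mem_add hφ.1 hφ'.1))
  have lc := jc.2 (completeSet_add_subset_join (Set.add_mem_add hc.1 hc'.1))
  have lχ := chromaticNumber_join_toNat_le (G := G) (H := H)
  obtain ⟨-, h1, h2, h3, h4, h5, h6⟩ := hG
  obtain ⟨-, h1', h2', h3', h4', h5', h6'⟩ := hH
  constructor <;> first | exact hne | omega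

theorem fallAchromaticNumber_join (hG : (fallSet G).Nonempty) (hH : (fallSet H).Nonempty) :
    fallAchromaticNumber (join G H) = fallAchromaticNumber G + fallAchromaticNumber H := by
  have hne : (fallSet (join G H)).Nonempty := by
    rw [fallSet_join]
    exact hG.add hH
  exact (isGreatest_numbers hne).2.1.unique (fallSet_join (G := G) (H := H) ▸
    isGreatest_add (isGreatest_numbers hG).2.1 (isGreatest_numbers hH).2.1)

theorem partialGrundyNumber_join (hG : (fallSet G).Nonempty) (hH : (fallSet H).Nonempty) :
    partialGrundyNumber (join G H) = partialGrundyNumber G + partialGrundyNumber H := by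
  have hne : (fallSet (join G H)).Nonempty := by
    rw [fallSet_join]
    exact hG.add hH
  exact (isGreatest_numbers hne).2.2.2.2.1.unique (partialGrundySet_join (G := G) (H := H) ▸
    isGreatest_add (isGreatest_numbers hG).2.2.2.2.1 (isGreatest_numbers hH).2.2.2.2.1)

end finite

/-! ### Disjoint unions -/

theorem isColorfulVertex_inl_iff {f : (G ⊕g H).Coloring (Fin k)} {v : V} :
    IsColorfulVertex f (.inl v) ↔ IsColorfulVertex f.sumLeft v := by
  simp only [IsColorfulVertex, Sum.exists]
  refine forall_congr' fun c => ⟨?_, fun ⟨w, hw, h⟩ => .inl ⟨w, by simpa using hw, h⟩⟩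
  rintro (⟨w, hw, h⟩ | ⟨w, hw, h⟩)
  · exact ⟨w, by simpa using hw, h⟩
  · simp at hw

theorem isColorfulVertex_inr_iff {f : (G ⊕g H).Coloring (Fin k)} {w : W} :
    IsColorfulVertex f (.inr w) ↔ IsColorfulVertex f.sumRight w := by
  simp only [IsColorfulVertex, Sum.exists]
  refine forall_congr' fun c => ⟨?_, fun ⟨w, hw, h⟩ => .inr ⟨w, by simpa using hw, h⟩⟩
  rintro (⟨w, hw, h⟩ | ⟨w, hw, h⟩)
  · simp at hw
  · exact ⟨w, by simpa using hw, h⟩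

/-- Closed neighborhoods stay within one part, so both parts need fall colorings with the same
number of colors. A second part can thus exclude unwanted values. -/
theorem fallSet_sum : fallSet (G ⊕g H) = fallSet G ∩ fallSet H := by
  apply subset_antisymm
  · rintro k ⟨hk, f, hf⟩
    exact ⟨⟨hk, f.sumLeft, fun v => isColorfulVertex_inl_iff.1 (hf _)⟩,
      hk, f.sumRight, fun v => isColorfulVertex_inr_iff.1 (hf _)⟩
  · rintro k ⟨⟨hk, f, hf⟩, -, g, hg⟩
    refine ⟨hk, f.sum g, ?_⟩
    rintro (v | v)
    · exact isColorfulVertex_inl_iff.2 (by simpa using hf v)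
    · exact isColorfulVertex_inr_iff.2 (by simpa using hg v)

theorem IsGrundyVertex.sum_inl {f : G.Coloring (Fin k)} {g : H.Coloring (Fin k)} {v : V}
    (hf : IsGrundyVertex f v) : IsGrundyVertex (f.sum g) (.inl v) := by
  intro c hc
  obtain ⟨w, hw, h⟩ := hf c hc
  exact ⟨.inl w, hw, h⟩

theorem IsGrundyVertex.sum_inr {f : G.Coloring (Fin k)} {g : H.Coloring (Fin k)} {w : W}
    (hg : IsGrundyVertex g w) : IsGrundyVertex (f.sum g) (.inr w) := by
  intro c hc
  obtain ⟨w, hw, h⟩ := hg c hc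
  exact ⟨.inr w, hw, h⟩

/-! ### Tensor products of complete graphs -/

/-- The tensor product `K_m × K_n`. -/
def tensor (m n : ℕ) : SimpleGraph (Fin m × Fin n) where
  Adj p q := p.1 ≠ q.1 ∧ p.2 ≠ q.2
  symm.symm _ _ h := ⟨h.1.symm, h.2.symm⟩
  loopless := ⟨fun _ h => h.1 rfl⟩

/-- The first projection as a coloring. -/
def tensorFst (m n : ℕ) : (tensor m n).Coloring (Fin m) := Coloring.mk Prod.fst fun h => h.1

/-- The second projection as a coloring. -/
def tensorSnd (m n : ℕ) : (tensor m n).Coloring (Fin n) := Coloring.mk Prod.snd fun h => h.2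

theorem isFallColoring_tensorFst {m n : ℕ} (hn : 2 ≤ n) : IsFallColoring (tensorFst m n) := by
  rintro ⟨i, j⟩ c
  have := Fin.nontrivial_iff_two_le.2 hn
  obtain ⟨j', hj⟩ := exists_ne j
  by_cases h : c = i
  · exact ⟨(i, j), .inl rfl, h.symm⟩
  · exact ⟨(c, j'), .inr ⟨Ne.symm h, hj.symm⟩, rfl⟩

theorem isFallColoring_tensorSnd {m n : ℕ} (hm : 2 ≤ m) : IsFallColoring (tensorSnd m n) := by
  rintro ⟨i, j⟩ c
  have := Fin.nontrivial_iff_two_le.2 hm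
  obtain ⟨i', hi⟩ := exists_ne i
  by_cases h : c = j
  · exact ⟨(i, j), .inl rfl, h.symm⟩
  · exact ⟨(i', c), .inr ⟨hi.symm, Ne.symm h⟩, rfl⟩

theorem mem_fallSet_tensor_left {m n : ℕ} (hm : 0 < m) (hn : 2 ≤ n) : m ∈ fallSet (tensor m n) :=
  ⟨hm, _, isFallColoring_tensorFst hn⟩

theorem mem_fallSet_tensor_right {m n : ℕ} (hm : 2 ≤ m) (hn : 0 < n) : n ∈ fallSet (tensor m n) :=
  ⟨hn, _, isFallColoring_tensorSnd hm⟩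

/-- If some color repeats in row 0, every vertex of row 1 is adjacent to one of its two occurrences,
so that color is absent from row 1. Vertices of row 0 must then carry it themselves, and a vertex of
row 1 sees only two colors. -/
theorem le_two_or_le_of_mem_fallSet_tensor {n : ℕ} (hk : k ∈ fallSet (tensor 2 n)) :
    k ≤ 2 ∨ n ≤ k := by
  obtain ⟨hk, f, hf⟩ := hk
  by_cases hinj : Function.Injective fun i => f (0, i)
  · right
    simpa using Fintype.card_le_of_injective _ hinj
  left
  simp only [Function.Injective] at hinj
  push Not at hinj
  obtain ⟨i, j, hij, hne⟩ := hinj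
  have h1 (l) : f (1, l) ≠ f (0, i) := by
    intro h
    by_cases hl : l = i
    · exact f.valid (v := (1, l)) (w := (0, j)) ⟨by simp, by simpa [hl] using hne⟩ (h.trans hij)
    · exact f.valid (v := (1, l)) (w := (0, i)) ⟨by simp, hl⟩ h
  have h0 (l) : f (0, l) = f (0, i) := by
    obtain ⟨⟨s, w⟩, h | h, hw⟩ := hf (0, l) (f (0, i))
    · rw [← h, hw]
    · have : s = 1 := by
        have := h.1
        simp only at this
        omega
      exact absurd hw (this ▸ h1 w)
  have h2 : (Finset.univ : Finset (Fin k)) ⊆ {f (0, i), f (1, i)} := by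
    intro c _
    obtain ⟨⟨s, w⟩, h | h, rfl⟩ := hf (1, i) c
    · simp [h]
    · have : s = 0 := by
        have := h.1
        simp only at this
        omega
      subst this
      simp [h0 w]
  simpa using (Finset.card_le_card h2).trans Finset.card_le_two

/-- The diagonal vertices form a triangle. -/
theorem three_le_of_tensor {n : ℕ} (hn : 3 ≤ n) (f : (tensor 3 n).Coloring (Fin k)) : 3 ≤ k := by
  have h : Function.Injective fun i : Fin 3 => f (i, Fin.castLE hn i) := by
    intro i j hij
    by_contra hne
    exact f.valid (v := (i, Fin.castLE hn i)) (w := (j, Fin.castLE hn j))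
      ⟨hne, fun h => hne (Fin.castLE_injective hn h)⟩ hij
  simpa using Fintype.card_le_of_injective _ h

theorem hasGaps_tensor {n : ℕ} (hn : 2 ≤ n) : HasGaps (tensor 2 n) 0 (n - 2) 0 0 0 0 := by
  have : NeZero n := ⟨by omega⟩
  have h2 := mem_fallSet_tensor_left (m := 2) (by omega) hn
  have h := isGreatest_numbers ⟨2, h2⟩
  have h3 := h.1.2 h2
  have h4 := h.2.1.2 (mem_fallSet_tensor_right (m := 2) le_rfl (by omega))
  exact { hasGaps_zero ⟨2, h2⟩ with fallAchrom_fall := by omega }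

theorem hasGaps_tensor_sum_tensor {n : ℕ} (hn : 3 ≤ n) :
    HasGaps (tensor 2 n ⊕g tensor 3 n) (n - 3) 0 0 0 0 0 := by
  have : NeZero n := ⟨by omega⟩
  have hne : (fallSet (tensor 2 n ⊕g tensor 3 n)).Nonempty := by
    rw [fallSet_sum]
    exact ⟨n, mem_fallSet_tensor_right le_rfl (by omega),
      mem_fallSet_tensor_right (by omega) (by omega)⟩
  have h := (isGreatest_numbers hne).1.1
  rw [fallSet_sum] at h
  have h1 := le_two_or_le_of_mem_fallSet_tensor h.1
  obtain ⟨-, -, f, -⟩ := h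
  have h2 := three_le_of_tensor hn f
  have h3 : (tensor 2 n ⊕g tensor 3 n).Colorable 3 :=
    Colorable.sum_max (n := 2) (m := 3) ⟨tensorFst 2 n⟩ ⟨tensorFst 3 n⟩
  have h4 := ENat.toNat_le_of_le_natCast h3.chromaticNumber_le
  exact { hasGaps_zero hne with fall_chrom := by omega }

theorem hasGaps_tensor_sum_top {n : ℕ} (hn : 2 ≤ n) :
    HasGaps (tensor 2 n ⊕g (⊤ : SimpleGraph (Fin 2))) 0 0 (n - 2) 0 0 0 := by
  have : NeZero n := ⟨by omega⟩
  have hne : (fallSet (tensor 2 n ⊕g (⊤ : SimpleGraph (Fin 2)))).Nonempty := by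
    rw [fallSet_sum]
    refine ⟨2, mem_fallSet_tensor_left (by omega) hn, by omega, Coloring.mk id fun h => h, ?_⟩
    intro v c
    exact ⟨c, by simpa [eq_comm] using eq_or_ne c v, rfl⟩
  obtain ⟨-, hψ, -, hΓ, -⟩ := isGreatest_numbers hne
  have h1 := hψ.1
  rw [fallSet_sum] at h1
  obtain ⟨-, -, f, hf⟩ := h1
  have h2 := le_card_of_forall_exists hf.exists_eq
  rw [Fintype.card_fin] at h2
  -- K₂ takes the two lowest colors, which keeps its vertices Grundy although they see few colors.
  let g : (⊤ : SimpleGraph (Fin 2)).Coloring (Fin n) :=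
    Coloring.mk (Fin.castLE hn) fun h e => h (Fin.castLE_injective hn e)
  have h3 : n ∈ grundySet (tensor 2 n ⊕g (⊤ : SimpleGraph (Fin 2))) := by
    refine ⟨by omega, (tensorSnd 2 n).sum g, fun c => ⟨.inl (0, c), rfl⟩, ?_⟩
    rintro (v | v)
    · exact ((isFallColoring_tensorSnd le_rfl).isGrundyVertex v).sum_inl
    · refine IsGrundyVertex.sum_inr fun c hc => ?_
      have hc' : (c : ℕ) < v := hc
      exact ⟨⟨c, by omega⟩, fun h => by simp [h] at hc', rfl⟩
  have h4 := hΓ.2 h3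
  exact { hasGaps_zero hne with grundy_fallAchrom := by omega }

/-! ### Copies of complete bipartite graphs -/

/-- Disjoint copies, indexed by `ι`, of the complete bipartite graph `K_{n,n}`. -/
def bicliques (ι : Type*) (n : ℕ) : SimpleGraph (ι × Bool × Fin n) where
  Adj p q := p.1 = q.1 ∧ p.2.1 ≠ q.2.1
  symm.symm _ _ h := ⟨h.1.symm, h.2.symm⟩
  loopless := ⟨fun _ h => h.2 rfl⟩

section bicliques

variable {ι : Type*} {n : ℕ}

/-- The coloring of `bicliques ι n` that gives color `c i` to one side of the copy `i` and the
colors `d i x` to the other one. -/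
def bicliquesColoring (c : ι → Fin k) (d : ι → Fin n → Fin k) (h : ∀ i x, d i x ≠ c i) :
    (bicliques ι n).Coloring (Fin k) :=
  Coloring.mk (fun p => if p.2.1 then c p.1 else d p.1 p.2.2) <| by
    rintro ⟨i, s, x⟩ ⟨j, t, y⟩ ⟨hij, hst⟩
    obtain rfl : i = j := hij
    cases s <;> cases t <;> simp_all [eq_comm]

/-- A vertex of color 2 would have neighbors of colors 0 and 1 on the opposite side. The latter
needs a neighbor of color 0, which is adjacent to the former. -/
theorem le_two_of_mem_grundySet_bicliques (hk : k ∈ grundySet (bicliques ι n)) : k ≤ 2 := by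
  obtain ⟨-, f, hf⟩ := hk
  by_contra hlt
  push Not at hlt
  obtain ⟨v, hv⟩ := hf.1 ⟨2, hlt⟩
  obtain ⟨u₀, hu₀, h₀⟩ := hf.2 v ⟨0, by omega⟩ (by simp [hv, Fin.lt_def])
  obtain ⟨u₁, hu₁, h₁⟩ := hf.2 v ⟨1, by omega⟩ (by simp [hv, Fin.lt_def])
  obtain ⟨w, hw, h⟩ := hf.2 u₁ ⟨0, by omega⟩ (by simp [h₁, Fin.lt_def])
  refine f.valid (v := u₀) (w := w) ⟨hu₀.1.symm.trans (hu₁.1.trans hw.1), ?_⟩ (h₀.trans h.symm)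
  have h1 := hu₀.2
  have h2 := hu₁.2
  have h3 := hw.2
  revert h1 h2 h3
  cases v.2.1 <;> cases u₀.2.1 <;> cases u₁.2.1 <;> cases w.2.1 <;> simp

theorem two_mem_fallSet_bicliques : 2 ∈ fallSet (bicliques ι n) := by
  refine ⟨by omega, bicliquesColoring (fun _ => 1) (fun _ _ => 0) (by simp), ?_⟩
  rintro ⟨i, s, x⟩ c
  by_cases h : c = if s then 1 else 0
  · exact ⟨_, .inl rfl, h.symm⟩
  · refine ⟨(i, !s, x), .inr ⟨rfl, by simp⟩, ?_⟩
    change (if (!s) = true then (1 : Fin 2) else 0) = c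
    cases s <;> simp at h ⊢ <;> omega

/-- In copy `i`, the `n` vertices of one side carry all colors other than `c i`, so the opposite
vertices are colorful. -/
theorem mem_colorfulSet_bicliques (hn : 0 < n) (c : ι → Fin (n + 1)) (hc : c.Surjective) :
    n + 1 ∈ colorfulSet (bicliques ι n) := by
  refine ⟨by omega, bicliquesColoring c (fun i => (c i).succAbove)
    (fun i x => Fin.succAbove_ne _ _), fun a => ?_⟩
  obtain ⟨i, rfl⟩ := hc a
  refine ⟨(i, true, ⟨0, hn⟩), rfl, fun b => ?_⟩
  by_cases h : b = c i
  · exact ⟨_, .inl rfl, h.symm⟩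
  · obtain ⟨x, hx⟩ := Fin.exists_succAbove_eq h
    exact ⟨(i, false, x), .inr ⟨rfl, by simp⟩, hx⟩

/-- One copy is spent on each ordered pair of distinct colors, encoded by `succAbove`; hence `k` is
not limited by the degree `n`. -/
theorem mem_completeSet_bicliques (hn : 0 < n) (c : ι → Fin (k + 1) × Fin k)
    (hc : c.Surjective) : k + 1 ∈ completeSet (bicliques ι n) := by
  refine ⟨by omega, bicliquesColoring (fun i => (c i).1) (fun i _ => (c i).1.succAbove (c i).2)
    (fun i x => Fin.succAbove_ne _ _), fun a b hab => ?_⟩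
  obtain ⟨x, hx⟩ := Fin.exists_succAbove_eq hab.symm
  obtain ⟨i, hi⟩ := hc (a, x)
  refine ⟨(i, true, ⟨0, hn⟩), (i, false, ⟨0, hn⟩), ⟨rfl, by simp⟩, ?_, ?_⟩
  · exact congrArg Prod.fst hi
  · change (c i).1.succAbove (c i).2 = b
    rw [hi, hx]

theorem maxDegree_bicliques_le [Fintype ι] [DecidableRel (bicliques ι n).Adj] :
    (bicliques ι n).maxDegree ≤ n := by
  classical
  refine maxDegree_le_of_forall_degree_le _ _ fun ⟨i, s, x⟩ => ?_
  have h : (bicliques ι n).neighborFinset (i, s, x) ⊆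
      (Finset.univ : Finset (Fin n)).image fun y => (i, !s, y) := by
    rintro ⟨j, t, y⟩ h
    obtain ⟨h1, h2⟩ := (mem_neighborFinset _ _ _).1 h
    simp only at h1 h2
    subst h1
    exact Finset.mem_image.2 ⟨y, Finset.mem_univ _, by cases s <;> cases t <;> simp_all⟩
  rw [← card_neighborFinset_eq_degree]
  simpa using (Finset.card_le_card h).trans Finset.card_image_le

theorem hasGaps_bicliques [Fintype ι] [Nonempty ι] (hn : 0 < n) (c : ι → Fin (n + 1))
    (hc : c.Surjective) (d : ι → Fin (k + 1) × Fin k) (hd : d.Surjective) :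
    HasGaps (bicliques ι n) 0 0 0 (n - 1) (k - n) (n - 1) := by
  classical
  have : NeZero n := ⟨hn.ne'⟩
  have hne : (fallSet (bicliques ι n)).Nonempty := ⟨2, two_mem_fallSet_bicliques⟩
  obtain ⟨-, hψ, hφ, hΓ, hp, hc'⟩ := isGreatest_numbers hne
  have h1 := le_two_of_mem_grundySet_bicliques hΓ.1
  have h2 := le_two_of_mem_grundySet_bicliques (fallSet_subset_grundySet hψ.1)
  have h3 := mem_colorfulSet_bicliques hn c hc
  have h4 := hφ.2 h3
  have h5 := hp.2 (colorfulSet_subset_partialGrundySet h3)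
  have h6 := hc'.2 (mem_completeSet_bicliques hn d hd)
  -- Covers the case `k < n`, where the gap `k - n` truncates to 0.
  have h8 := hc'.2 (partialGrundySet_subset_completeSet hp.1)
  have h7 := (le_of_mem_partialGrundySet hp.1).trans (Nat.succ_le_succ maxDegree_bicliques_le)
  exact { hasGaps_zero hne with
    b_fallAchrom := by omega
    achrom_partial := by omega
    partial_grundy := by omega }

end bicliques

/-! ### Edgeless graphs -/

theorem fallSet_bot_nonempty : (fallSet (⊥ : SimpleGraph V)).Nonempty := by
  refine ⟨1, one_pos, Coloring.mk (fun _ => 0) (by simp), fun v c => ⟨v, .inl rfl, ?_⟩⟩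
  exact Subsingleton.elim _ _

theorem partialGrundyNumber_bot_le [Fintype V] [Nonempty V] :
    partialGrundyNumber (⊥ : SimpleGraph V) ≤ 1 := by
  have h := (isGreatest_numbers (fallSet_bot_nonempty (V := V))).2.2.2.2.1.1
  simpa using le_of_mem_partialGrundySet h

theorem fallAchromaticNumber_bot_le [Fintype V] [Nonempty V] :
    fallAchromaticNumber (⊥ : SimpleGraph V) ≤ 1 := by
  have h := (isGreatest_numbers (fallSet_bot_nonempty (V := V))).2.1.1
  simpa using le_of_mem_fallSet h

/-- The join with an edgeless graph adds to the gaps gaps below the minimum and the maximum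
degree. -/
theorem HasGaps.gaps_degree_join_bot [Fintype V] [Nonempty V] [Fintype W] [Nonempty W]
    {a₁ a₂ a₃ a₄ a₅ a₆ m : ℕ} (hG : HasGaps G a₁ a₂ a₃ a₄ a₅ a₆) (h₄ : m ≤ a₄)
    (hW : m + 1 ≤ Fintype.card W) [DecidableRel (FallColoring.join G (⊥ : SimpleGraph W)).Adj] :
    fallAchromaticNumber (FallColoring.join G (⊥ : SimpleGraph W)) + m ≤
        (FallColoring.join G (⊥ : SimpleGraph W)).minDegree + 1 ∧
      partialGrundyNumber (FallColoring.join G (⊥ : SimpleGraph W)) + m ≤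
        (FallColoring.join G (⊥ : SimpleGraph W)).maxDegree + 1 := by
  classical
  have hne := hG.nonempty
  rw [fallAchromaticNumber_join hne fallSet_bot_nonempty,
    partialGrundyNumber_join hne fallSet_bot_nonempty]
  have h1 := partialGrundyNumber_bot_le (V := W)
  have h2 := fallAchromaticNumber_bot_le (V := W)
  obtain ⟨-, hψ, hφ, -, hp, -⟩ := isGreatest_numbers hne
  have h3 := le_of_mem_fallSet hψ.1
  have h4 := le_of_mem_partialGrundySet hp.1
  have h5 := hG.b_fallAchrom
  obtain ⟨-, f, hf⟩ := hφ.1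
  have h6 := le_card_of_forall_exists fun c => (hf c).imp fun _ h => h.1
  constructor
  · have : G.minDegree + Fintype.card W ≤
        (FallColoring.join G (⊥ : SimpleGraph W)).minDegree ∨
        Fintype.card V ≤ (FallColoring.join G (⊥ : SimpleGraph W)).minDegree := by
      obtain ⟨v | w, hv⟩ :=
        (FallColoring.join G (⊥ : SimpleGraph W)).exists_minimal_degree_vertex
      · have := le_degree_join_inl (G := G) (H := (⊥ : SimpleGraph W)) v
        have := G.minDegree_le_degree v
        omega
      · have := le_degree_join_inr (G := G) (H := (⊥ : SimpleGraph W)) w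
        omega
    omega
  · obtain ⟨v, hv⟩ := G.exists_maximal_degree_vertex
    have h7 := le_degree_join_inl (G := G) (H := (⊥ : SimpleGraph W)) v
    have h8 := (FallColoring.join G (⊥ : SimpleGraph W)).degree_le_maxDegree (.inl v)
    omega

end FallColoring

/-! ### Assembling the graph. -/

theorem theorem3 (ε : ℤ) (hε : 0 < ε) :
    ∃ (V : Type) (_ : Fintype V) (_ : Nonempty V) (G : SimpleGraph V) (_ : DecidableRel G.Adj),
      (FallColoring.fallSet G).Nonempty ∧
      ε < (FallColoring.fallChromaticNumber G : ℤ) - (G.chromaticNumber.toNat : ℤ) ∧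
      ε < (FallColoring.fallAchromaticNumber G : ℤ) - (FallColoring.fallChromaticNumber G : ℤ) ∧
      ε < ((G.minDegree : ℤ) + 1) - (FallColoring.fallAchromaticNumber G : ℤ) ∧
      ε < (FallColoring.grundyNumber G : ℤ) - (FallColoring.fallAchromaticNumber G : ℤ) ∧
      ε < (FallColoring.bChromaticNumber G : ℤ) - (FallColoring.fallAchromaticNumber G : ℤ) ∧
      ε < ((G.maxDegree : ℤ) + 1) - (FallColoring.partialGrundyNumber G : ℤ) ∧
      ε < (FallColoring.achromaticNumber G : ℤ) - (FallColoring.partialGrundyNumber G : ℤ) ∧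
      ε < (FallColoring.partialGrundyNumber G : ℤ) - (FallColoring.grundyNumber G : ℤ) := by
  classical
  obtain ⟨e, rfl⟩ := Int.eq_ofNat_of_zero_le hε.le
  -- The weakest piece contributes `n - 3 = e + 1`; `k = 2 * n` makes `k - n = n`. The index type
  -- `ι` is a product so that it projects onto both families of copies required.
  let n := e + 4
  let k := 2 * n
  let ι := Fin (n + 1) × Fin (k + 1) × Fin k
  have hbic := FallColoring.hasGaps_bicliques (ι := ι) (n := n) (k := k) (by omega)
    Prod.fst Prod.fst_surjective Prod.snd Prod.snd_surjective
  have hX := ((hbic.join (FallColoring.hasGaps_tensor (n := n) (by omega))).join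
    (FallColoring.hasGaps_tensor_sum_tensor (n := n) (by omega))).join
    (FallColoring.hasGaps_tensor_sum_top (n := n) (by omega))
  have hG := hX.join (FallColoring.hasGaps_zero
    (FallColoring.fallSet_bot_nonempty (V := Fin (e + 2))))
  have hdeg := hX.gaps_degree_join_bot (W := Fin (e + 2)) (m := e + 1) (by omega) (by simp)
  obtain ⟨hne, h1, h2, h3, h4, h5, h6⟩ := hG
  refine ⟨_, inferInstance, inferInstance, _, Classical.decRel _, hne,
    ?_, ?_, ?_, ?_, ?_, ?_, ?_, ?_⟩ <;> omega
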